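/- Consider the Gaussian interference relay-without-delay channel with real gains $h_{ik}, h_{Rk}$ ($i,k\in\{1,2\}$) and $\mathbf h_{iR}=[h_{iR}^{[1]},h_{iR}^{[2]}]\in\mathbb R^2$: in each use, $$Y_R=h_{R1}X_1+h_{R2}X_2+Z_R,\qquad Y_i=h_{i1}X_1+h_{i2}X_2+\mathbf h_{iR}\mathbf X_R+Z_i\quad(i=1,2),$$ where $X_1,X_2\in\mathbb R$ are sent by the two sources, $\mathbf X_R\in\mathbb R^2$ is sent by the relay, and the noises $Z_R,Z_1,Z_2\sim N(0,1)$ are independent of each other and of $X_1,X_2$. For random variables let $I(U;V|W)\in[0,\infty]$ be the conditional mutual information, that is, the Kullback--Leibler divergence of $P_{W,U,V}$ from $P_W\otimes(P_{U|W}\times P_{V|W})$. The channel has strong interference if, for all independent $X_1\sim p(x_1)$, $X_2\sim p(x_2)$ and every conditional law $p(x_R|y_R)$ by which $\mathbf X_R$ is drawn from $Y_R$ (with $\mathbf X_R$ conditionally independent of $(X_1,X_2,Z_R)$ given $Y_R$, and with $(Z_1,Z_2)$ independent of $(X_1,X_2,Z_R,\mathbf X_R)$), $$I(X_1;Y_1|X_2,Y_R,\mathbf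 X_R)\le I(X_1;Y_2|X_2,Y_R,\mathbf X_R),\qquad I(X_2;Y_2|X_1,Y_R,\mathbf X_R)\le I(X_2;Y_1|X_1,Y_R,\mathbf X_R).$$ Lemma 2. Suppose the channel has strong interference. Let $n\ge1$, let $X_1^n\sim p(x_1^n)$ and $X_2^n\sim p(x_2^n)$ be independent with arbitrary laws on $\mathbb R^n$, let the channel be used $n$ times with noise that is i.i.d. over time and independent of $(X_1^n,X_2^n)$, and let the relay send $\mathbf X_{R,j}=f_j(Y_{R,1},\dots,Y_{R,j})$ for $1\le j\le n$, where $f_j:\mathbb R^j\to\mathbb R^2$ are arbitrary measurable functions. Then $$I(X_1^n;Y_1^n|X_2^n,Y_R^n)\le I(X_1^n;Y_2^n|X_2^n,Y_R^n),\qquad I(X_2^n;Y_2^n|X_1^n,Y_R^n)\le I(X_2^n;Y_1^n|X_1^n,Y_R^n).$$ -/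

import Mathlib

open MeasureTheory ProbabilityTheory
open scoped ENNReal Matrix

noncomputable section

/-- Conditional mutual information `I(X; Y | Z)` in nats of three random variables on `(Ω, μ)`:
the Kullback-Leibler divergence of the joint law `P_{Z,X,Y}` from the law
`P_Z ⊗ (P_{X|Z} × P_{Y|Z})` under which `X` and `Y` are conditionally independent given `Z`.
It takes values in `[0, ∞]` and is defined for arbitrary (discrete, continuous, mixed) laws. -/
def condMutualInfo {Ω A B C : Type*} [MeasurableSpace Ω]
    [MeasurableSpace A] [StandardBorelSpace A] [Nonempty A]
    [MeasurableSpace B] [StandardBorelSpace B] [Nonempty B] [MeasurableSpace C]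
    (μ : Measure Ω) [IsFiniteMeasure μ] (X : Ω → A) (Y : Ω → B) (Z : Ω → C) : ℝ≥0∞ :=
  InformationTheory.klDiv (μ.map fun ω => (Z ω, X ω, Y ω))
    (μ.map Z ⊗ₘ (condDistrib X Z μ ×ₖ condDistrib Y Z μ))

/-- The channel gains of a Gaussian interference relay-without-delay channel. The relay has one
receiving and two transmitting antennas; `hij` is the gain from source `j` to destination `i`,
`hRj` the gain from source `j` to the relay, `hiR k` the gain from the `k`-th transmitting antenna
of the relay to destination `i`. All noises have unit variance. -/
structure GaussianIRC where
  h11 : ℝ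
  h12 : ℝ
  h21 : ℝ
  h22 : ℝ
  hR1 : ℝ
  hR2 : ℝ
  h1R : Fin 2 → ℝ
  h2R : Fin 2 → ℝ

namespace GaussianIRC

/-- The symbol received by the relay in one channel use. -/
def relayOut (c : GaussianIRC) (x1 x2 zR : ℝ) : ℝ :=
  c.hR1 * x1 + c.hR2 * x2 + zR

/-- The symbol received by destination 1 in one channel use. -/
def out1 (c : GaussianIRC) (x1 x2 : ℝ) (xR : Fin 2 → ℝ) (z1 : ℝ) : ℝ :=
  c.h11 * x1 + c.h12 * x2 + c.h1R ⬝ᵥ xR + z1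

/-- The symbol received by destination 2 in one channel use. -/
def out2 (c : GaussianIRC) (x1 x2 : ℝ) (xR : Fin 2 → ℝ) (z2 : ℝ) : ℝ :=
  c.h21 * x1 + c.h22 * x2 + c.h2R ⬝ᵥ xR + z2

theorem measurable_relayOut (c : GaussianIRC) :
    Measurable fun p : ℝ × ℝ × ℝ => c.relayOut p.1 p.2.1 p.2.2 := by
  unfold relayOut
  fun_prop

/-! ### One channel use with a randomized relay -/

/-- Sample points `(((x1, x2, zR), xR), (z1, z2))` of one channel use. -/
abbrev Use : Type := ((ℝ × ℝ × ℝ) × (Fin 2 → ℝ)) × (ℝ × ℝ)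

/-- The law of one channel use: `X1 ∼ μ1`, `X2 ∼ μ2` and the standard normal noises `ZR`, `Z1`, `Z2`
are independent, and the relay draws `XR` from `κ (· | yR)` where `yR` is its received symbol. -/
def useLaw (c : GaussianIRC) (μ1 μ2 : Measure ℝ) (κ : Kernel ℝ (Fin 2 → ℝ)) : Measure Use :=
  ((μ1.prod (μ2.prod (gaussianReal 0 1))) ⊗ₘ
      κ.comap (fun p : ℝ × ℝ × ℝ => c.relayOut p.1 p.2.1 p.2.2) c.measurable_relayOut).prod
    ((gaussianReal 0 1).prod (gaussianReal 0 1))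

instance (c : GaussianIRC) (μ1 μ2 : Measure ℝ) [IsProbabilityMeasure μ1] [IsProbabilityMeasure μ2]
    (κ : Kernel ℝ (Fin 2 → ℝ)) [IsMarkovKernel κ] : IsProbabilityMeasure (c.useLaw μ1 μ2 κ) := by
  unfold useLaw
  infer_instance

def useX1 (ω : Use) : ℝ := ω.1.1.1

def useX2 (ω : Use) : ℝ := ω.1.1.2.1

def useYR (c : GaussianIRC) (ω : Use) : ℝ := c.relayOut (useX1 ω) (useX2 ω) ω.1.1.2.2

def useXR (ω : Use) : Fin 2 → ℝ := ω.1.2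

def useY1 (c : GaussianIRC) (ω : Use) : ℝ := c.out1 (useX1 ω) (useX2 ω) (useXR ω) ω.2.1

def useY2 (c : GaussianIRC) (ω : Use) : ℝ := c.out2 (useX1 ω) (useX2 ω) (useXR ω) ω.2.2

/-- Strong interference: `I(X1;Y1|X2,YR,XR) ≤ I(X1;Y2|X2,YR,XR)` and
`I(X2;Y2|X1,YR,XR) ≤ I(X2;Y1|X1,YR,XR)` for all laws `p(x1) p(x2)` of the inputs and all
conditional laws `p(xR|yR)` of the relay's transmit symbol. -/
def StrongInterference (c : GaussianIRC) : Prop :=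
  ∀ (μ1 μ2 : Measure ℝ) [IsProbabilityMeasure μ1] [IsProbabilityMeasure μ2]
    (κ : Kernel ℝ (Fin 2 → ℝ)) [IsMarkovKernel κ],
    condMutualInfo (c.useLaw μ1 μ2 κ) useX1 c.useY1 (fun ω => (useX2 ω, c.useYR ω, useXR ω))
        ≤ condMutualInfo (c.useLaw μ1 μ2 κ) useX1 c.useY2
            (fun ω => (useX2 ω, c.useYR ω, useXR ω)) ∧
      condMutualInfo (c.useLaw μ1 μ2 κ) useX2 c.useY2 (fun ω => (useX1 ω, c.useYR ω, useXR ω))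
        ≤ condMutualInfo (c.useLaw μ1 μ2 κ) useX2 c.useY1
            (fun ω => (useX1 ω, c.useYR ω, useXR ω))

/-! ### `n` uses of the memoryless channel with a deterministic relay without delay -/

/-- Real sequences of length `n`. -/
abbrev Seq (n : ℕ) : Type := Fin n → ℝ

/-- Relay functions `f_1, …, f_n`. Times are numbered from `0`, so that the function used at time
`j : Fin n` takes the `j + 1` symbols received up to and including time `j`. -/
abbrev RelayFun (n : ℕ) : Type := (j : Fin n) → Seq (j.val + 1) → (Fin 2 → ℝ)

/-- The first `j + 1` symbols of a sequence, those up to and including time `j`. -/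
def upTo {n : ℕ} (y : Seq n) (j : Fin n) : Seq (j.val + 1) :=
  fun i => y (Fin.castLE j.isLt i)

/-- Sample points `(x1, x2, zR, z1, z2)` of `n` channel uses. -/
abbrev Block (n : ℕ) : Type := Seq n × Seq n × Seq n × Seq n × Seq n

/-- The law of `n` independent standard normal variables. -/
def noiseLaw (n : ℕ) : Measure (Seq n) := Measure.pi fun _ => gaussianReal 0 1

instance (n : ℕ) : IsProbabilityMeasure (noiseLaw n) := by
  unfold noiseLaw
  infer_instance

/-- The input sequences have laws `μ1`, `μ2`, the three noise sequences are i.i.d. standard normal,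
and the five sequences are independent. -/
def blockLaw {n : ℕ} (μ1 μ2 : Measure (Seq n)) : Measure (Block n) :=
  μ1.prod (μ2.prod ((noiseLaw n).prod ((noiseLaw n).prod (noiseLaw n))))

instance {n : ℕ} (μ1 μ2 : Measure (Seq n)) [IsProbabilityMeasure μ1] [IsProbabilityMeasure μ2] :
    IsProbabilityMeasure (blockLaw μ1 μ2) := by
  unfold blockLaw
  infer_instance

variable {n : ℕ}

def blockX1 (ω : Block n) : Seq n := ω.1

def blockX2 (ω : Block n) : Seq n := ω.2.1

def blockYR (c : GaussianIRC) (ω : Block n) : Seq n :=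
  fun j => c.relayOut (blockX1 ω j) (blockX2 ω j) (ω.2.2.1 j)

/-- The symbols sent by the relay; the one at time `j` depends on the symbols it has received up to
and including time `j`. -/
def blockXR (c : GaussianIRC) (f : RelayFun n) (ω : Block n) : Fin n → (Fin 2 → ℝ) :=
  fun j => f j (upTo (c.blockYR ω) j)

def blockY1 (c : GaussianIRC) (f : RelayFun n) (ω : Block n) : Seq n :=
  fun j => c.out1 (blockX1 ω j) (blockX2 ω j) (c.blockXR f ω j) (ω.2.2.2.1 j)

def blockY2 (c : GaussianIRC) (f : RelayFun n) (ω : Block n) : Seq n :=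
  fun j => c.out2 (blockX1 ω j) (blockX2 ω j) (c.blockXR f ω j) (ω.2.2.2.2 j)

end GaussianIRC

end

/-! Strong interference is a statement about all one-use input laws, but only two test laws are
needed to turn it into inequalities between gains. Take `X1` standard normal, `X2 = 0` and a silent
relay. Given `YR`, the input `X1` is Gaussian with variance `1 / (hR1 ^ 2 + 1)`, so the two sides of
the condition are `log (1 + a ^ 2 / (hR1 ^ 2 + 1)) / 2` with `a = h11` and `a = h21`. This is
strictly increasing in `|a|`, hence `|h11| ≤ |h21|` (`StrongInterference.abs_h11_le`). Exchanging
the sources gives `|h22| ≤ |h12|`.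

The block inequality then needs no single-letter decomposition. Given `X2^n` and `YR^n`, the relay's
symbols are known, so each destination sees a multiple of `X1^n`, plus a known offset, plus white
noise independent of the inputs and of the relay's noise. Since `|h11| ≤ |h21|`, the output of
destination 1 has the same joint law with the input and the conditioning variable as a degraded
output of destination 2: remove the known offset, scale by `r = h11 / h21` (or `0` if `h21 = 0`),
add fresh noise of variance `1 - r ^ 2`, insert the other offset
(`condMutualInfo_le_of_abs_gain_le`). Data processing for the Kullback-Leibler divergence
(`condMutualInfo_le_of_channel`) concludes. It holds in `[0, ∞]`, so no densities or finite
entropies of the inputs are required. -/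

/-! ### Conditional mutual information and data processing. -/

section CondMutualInfo

variable {Ω Ω' A B B' C : Type*} [MeasurableSpace Ω] [MeasurableSpace Ω']
  [MeasurableSpace A] [StandardBorelSpace A] [Nonempty A]
  [MeasurableSpace B] [StandardBorelSpace B] [Nonempty B]
  [MeasurableSpace B'] [StandardBorelSpace B'] [Nonempty B'] [MeasurableSpace C]
  {μ : Measure Ω} [IsFiniteMeasure μ] {μ' : Measure Ω'} [IsFiniteMeasure μ']

/-- The conditional mutual information computed with any versions of the conditional laws. -/
theorem condMutualInfo_eq_klDiv_of_compProd {X : Ω → A} {Y : Ω → B} {Z : Ω → C}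
    (hX : Measurable X) (hY : Measurable Y) {κ : Kernel C A} {η : Kernel C B}
    [IsFiniteKernel κ] [IsFiniteKernel η]
    (hκ : μ.map (fun ω => (Z ω, X ω)) = μ.map Z ⊗ₘ κ)
    (hη : μ.map (fun ω => (Z ω, Y ω)) = μ.map Z ⊗ₘ η) :
    condMutualInfo μ X Y Z =
      InformationTheory.klDiv (μ.map fun ω => (Z ω, X ω, Y ω)) (μ.map Z ⊗ₘ (κ ×ₖ η)) := by
  have h1 := condDistrib_ae_eq_of_measure_eq_compProd Z hX.aemeasurable hκ
  have h2 := condDistrib_ae_eq_of_measure_eq_compProd Z hY.aemeasurable hη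
  unfold condMutualInfo
  congr 1
  refine Measure.compProd_congr ?_
  filter_upwards [h1, h2] with z hz1 hz2
  rw [Kernel.prod_apply, Kernel.prod_apply, hz1, hz2]

/-- The conditional mutual information only depends on the joint law. -/
theorem condMutualInfo_congr_map {X : Ω → A} {Y : Ω → B} {Z : Ω → C}
    {X' : Ω' → A} {Y' : Ω' → B} {Z' : Ω' → C}
    (hX : Measurable X) (hY : Measurable Y) (hZ : Measurable Z)
    (hX' : Measurable X') (hY' : Measurable Y') (hZ' : Measurable Z')
    (h : μ.map (fun ω => (Z ω, X ω, Y ω)) = μ'.map fun ω => (Z' ω, X' ω, Y' ω)) :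
    condMutualInfo μ X Y Z = condMutualInfo μ' X' Y' Z' := by
  have h1 : μ.map Z = μ'.map Z' := by
    have := congrArg (fun ν => ν.map fun p => p.1) h
    beta_reduce at this
    rwa [Measure.map_map (by fun_prop) (by fun_prop),
      Measure.map_map (by fun_prop) (by fun_prop)] at this
  have h2 : μ.map (fun ω => (Z ω, X ω)) = μ'.map fun ω => (Z' ω, X' ω) := by
    have := congrArg (fun ν => ν.map fun p => (p.1, p.2.1)) h
    beta_reduce at this
    rwa [Measure.map_map (by fun_prop) (by fun_prop),
      Measure.map_map (by fun_prop) (by fun_prop)] at this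
  have h3 : μ.map (fun ω => (Z ω, Y ω)) = μ'.map fun ω => (Z' ω, Y' ω) := by
    have := congrArg (fun ν => ν.map fun p => (p.1, p.2.2)) h
    beta_reduce at this
    rwa [Measure.map_map (by fun_prop) (by fun_prop),
      Measure.map_map (by fun_prop) (by fun_prop)] at this
  -- `condDistrib` is built from the joint law alone, so equal laws give equal kernels, not merely
  -- almost everywhere equal ones.
  unfold condMutualInfo
  simp only [condDistrib, h, h1, h2, h3]

/-- **Data processing**: the conditional mutual information decreases when the second variable is
passed through a channel `K` that may depend on the conditioning variable. -/
theorem condMutualInfo_le_of_channel {X : Ω → A} {Y : Ω → B} {Z : Ω → C}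
    {X' : Ω' → A} {Y' : Ω' → B'} {Z' : Ω' → C}
    (hX : Measurable X) (hY : Measurable Y) (hZ : Measurable Z)
    (hX' : Measurable X') (hY' : Measurable Y') (hZ' : Measurable Z')
    (K : Kernel (C × B) B') [IsMarkovKernel K]
    (h : ∀ f : C × A × B' → ℝ≥0∞, Measurable f →
      ∫⁻ ω, f (Z' ω, X' ω, Y' ω) ∂μ' = ∫⁻ ω, ∫⁻ y, f (Z ω, X ω, y) ∂K (Z ω, Y ω) ∂μ) :
    condMutualInfo μ' X' Y' Z' ≤ condMutualInfo μ X Y Z := by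
  -- `L` keeps `(z, x)` and replaces `y` by an output of `K` at `(z, y)`.
  let L : Kernel (C × A × B) (C × A × B') :=
    (Kernel.id ×ₖ K.comap (fun p : C × A × B => (p.1, p.2.2)) (by fun_prop)).map
      fun q => (q.1.1, q.1.2.1, q.2)
  have : IsMarkovKernel L := Kernel.IsMarkovKernel.map _ (by fun_prop)
  have hL : ∀ (f : C × A × B' → ℝ≥0∞), Measurable f → ∀ p,
      ∫⁻ q, f q ∂L p = ∫⁻ y, f (p.1, p.2.1, y) ∂K (p.1, p.2.2) := by
    intro f hf p
    rw [Kernel.lintegral_map _ (by fun_prop) _ hf, Kernel.lintegral_prod _ _ _ (by fun_prop),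
      Kernel.lintegral_id' (by fun_prop)]
    rfl
  have hZZ : μ'.map Z' = μ.map Z := by
    refine Measure.ext_of_lintegral _ fun f hf => ?_
    rw [lintegral_map hf hZ', lintegral_map hf hZ, h (fun p => f p.1) (by fun_prop)]
    simp
  have hXX : μ'.map (fun ω => (Z' ω, X' ω)) = μ.map fun ω => (Z ω, X ω) := by
    refine Measure.ext_of_lintegral _ fun f hf => ?_
    rw [lintegral_map hf (by fun_prop), lintegral_map hf (by fun_prop),
      h (fun p => f (p.1, p.2.1)) (by fun_prop)]
    simp
  have hcd : μ.map (fun ω => (Z ω, X ω)) = μ.map Z ⊗ₘ condDistrib X Z μ :=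
    (compProd_map_condDistrib hX.aemeasurable).symm
  have hcd' : μ.map (fun ω => (Z ω, Y ω)) = μ.map Z ⊗ₘ condDistrib Y Z μ :=
    (compProd_map_condDistrib hY.aemeasurable).symm
  -- A version of the law of `Y'` given `Z'`: draw `Y` given `Z`, then pass it through `K`.
  have hYY : μ'.map (fun ω => (Z' ω, Y' ω)) =
      μ'.map Z' ⊗ₘ (condDistrib Y Z μ ⊗ₖ K).snd := by
    rw [hZZ]
    refine Measure.ext_of_lintegral _ fun f hf => ?_
    rw [lintegral_map hf (by fun_prop), h (fun p => f (p.1, p.2.2)) (by fun_prop),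
      Measure.lintegral_compProd hf]
    have hK : Measurable fun p : C × B => ∫⁻ y, f (p.1, y) ∂K p :=
      Measurable.lintegral_kernel_prod_right' (f := fun q : (C × B) × B' => f (q.1.1, q.2))
        (by fun_prop)
    calc _ = ∫⁻ p : C × B, ∫⁻ y, f (p.1, y) ∂K p ∂(μ.map fun ω => (Z ω, Y ω)) := by
          rw [lintegral_map hK (by fun_prop)]
      _ = _ := by
          rw [hcd', Measure.lintegral_compProd hK]
          refine lintegral_congr fun z => ?_
          rw [Kernel.lintegral_snd _ _ (by fun_prop), Kernel.lintegral_compProd _ _ _ (by fun_prop)]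
  rw [condMutualInfo_eq_klDiv_of_compProd hX' hY' (by rw [hXX, hZZ, hcd]) hYY,
    condMutualInfo_eq_klDiv_of_compProd hX hY hcd hcd']
  -- Both the joint law and the conditionally independent law are transported by the same `L`. For
  -- the latter this works because `K` does not look at `x`.
  have hP : μ'.map (fun ω => (Z' ω, X' ω, Y' ω)) = L ∘ₘ μ.map fun ω => (Z ω, X ω, Y ω) := by
    refine Measure.ext_of_lintegral _ fun f hf => ?_
    rw [lintegral_map hf (by fun_prop), h f hf,
      Measure.lintegral_bind L.measurable.aemeasurable hf.aemeasurable,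
      lintegral_map hf.lintegral_kernel (by fun_prop)]
    exact lintegral_congr fun ω => (hL f hf (Z ω, X ω, Y ω)).symm
  have hQ : μ'.map Z' ⊗ₘ (condDistrib X Z μ ×ₖ (condDistrib Y Z μ ⊗ₖ K).snd) =
      L ∘ₘ (μ.map Z ⊗ₘ (condDistrib X Z μ ×ₖ condDistrib Y Z μ)) := by
    refine Measure.ext_of_lintegral _ fun f hf => ?_
    rw [Measure.lintegral_compProd hf,
      Measure.lintegral_bind L.measurable.aemeasurable hf.aemeasurable,
      Measure.lintegral_compProd hf.lintegral_kernel, hZZ]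
    refine lintegral_congr fun z => ?_
    rw [Kernel.lintegral_prod _ _ _ (by fun_prop),
      Kernel.lintegral_prod (g := fun b => ∫⁻ q, f q ∂L (z, b)) _ _ _
        (hf.lintegral_kernel.comp measurable_prodMk_left)]
    refine lintegral_congr fun x => ?_
    rw [Kernel.lintegral_snd _ _ (by fun_prop), Kernel.lintegral_compProd _ _ _ (by fun_prop)]
    exact lintegral_congr fun y => (hL f hf (z, x, y)).symm
  rw [hP, hQ]
  exact InformationTheory.klDiv_comp_right_le _ _ _

end CondMutualInfo

/-! ### Degradation of Gaussian outputs. -/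

/-- Linear combinations of independent centred normal variables. -/
theorem gaussianReal_prod_map_linear (r s : ℝ) (u v w : NNReal)
    (h : r ^ 2 * u + s ^ 2 * v = w) :
    ((gaussianReal 0 u).prod (gaussianReal 0 v)).map (fun p => r * p.1 + s * p.2) =
      gaussianReal 0 w := by
  have h1 : (fun p : ℝ × ℝ => r * p.1 + s * p.2) =
      (fun p : ℝ × ℝ => p.1 + p.2) ∘ Prod.map (fun x => r * x) (fun x => s * x) := rfl
  rw [h1, ← Measure.map_map (by fun_prop) (by fun_prop),
    ← Measure.map_prod_map _ _ (by fun_prop) (by fun_prop), gaussianReal_map_const_mul,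
    gaussianReal_map_const_mul]
  have h2 := gaussianReal_conv_gaussianReal (m₁ := r * 0) (m₂ := s * 0)
    (v₁ := .mk (r ^ 2) (sq_nonneg _) * u) (v₂ := .mk (s ^ 2) (sq_nonneg _) * v)
  rw [Measure.conv] at h2
  rw [h2]
  congr 1
  · simp
  · exact NNReal.eq (by simpa using h)

namespace GaussianIRC

/-- The coordinates combine separately, and a unit vector `(r, s)` preserves the unit variance. This
permits splitting the noise of the weaker output into a scaled copy of the stronger output's noise
and fresh noise. -/
theorem noiseLaw_prod_map_linear (n : ℕ) {r s : ℝ} (h : r ^ 2 + s ^ 2 = 1) :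
    ((noiseLaw n).prod (noiseLaw n)).map (fun p => r • p.1 + s • p.2) = noiseLaw n := by
  have h1 := (measurePreserving_arrowProdEquivProdArrow ℝ ℝ (Fin n)
    (fun _ => gaussianReal 0 1) (fun _ => gaussianReal 0 1)).map_eq
  unfold noiseLaw
  rw [← h1, Measure.map_map (by fun_prop) (MeasurableEquiv.measurable _)]
  have h2 := Measure.pi_map_pi (ι := Fin n)
    (μ := fun _ => (gaussianReal 0 1).prod (gaussianReal 0 1))
    (f := fun _ p => r * p.1 + s * p.2) (fun _ => by fun_prop)
  simp only [gaussianReal_prod_map_linear r s 1 1 1 (by simpa using h)] at h2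
  rw [← h2]
  rfl

/-- Adding white Gaussian noise: with the smaller gain, the output is a degraded version of the
output with the larger gain. The offsets `G₁`, `G₂` are known from the conditioning variable. -/
theorem condMutualInfo_le_of_abs_gain_le {Ω C : Type*} [MeasurableSpace Ω] [MeasurableSpace C]
    {μ : Measure Ω} [IsProbabilityMeasure μ] {n : ℕ} {X N₁ N₂ : Ω → Seq n} {W : Ω → C}
    {G₁ G₂ : C → Seq n} {a b : ℝ} (hab : |a| ≤ |b|)
    (hX : Measurable X) (hN₁ : Measurable N₁) (hN₂ : Measurable N₂) (hW : Measurable W)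
    (hG₁ : Measurable G₁) (hG₂ : Measurable G₂)
    (h₁ : μ.map (fun ω => ((W ω, X ω), N₁ ω)) =
      (μ.map fun ω => (W ω, X ω)).prod (noiseLaw n))
    (h₂ : μ.map (fun ω => ((W ω, X ω), N₂ ω)) =
      (μ.map fun ω => (W ω, X ω)).prod (noiseLaw n)) :
    condMutualInfo μ X (fun ω => a • X ω + G₁ (W ω) + N₁ ω) W ≤
      condMutualInfo μ X (fun ω => b • X ω + G₂ (W ω) + N₂ ω) W := by
  -- If `b = 0` then `a = 0`, and `r = 0` serves; otherwise `r = a / b`.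
  obtain ⟨r, hr, hr1⟩ : ∃ r : ℝ, a = r * b ∧ r ^ 2 ≤ 1 := by
    rcases eq_or_ne b 0 with rfl | hb
    · exact ⟨0, by simpa using hab, by norm_num⟩
    · refine ⟨a / b, by field_simp, ?_⟩
      rw [sq_le_one_iff_abs_le_one, abs_div]
      exact div_le_one_of_le₀ hab (abs_nonneg _)
  obtain ⟨s, hs⟩ : ∃ s : ℝ, r ^ 2 + s ^ 2 = 1 :=
    ⟨√(1 - r ^ 2), by rw [Real.sq_sqrt (by linarith)]; ring⟩
  -- The degrading channel: remove the offset `G₂`, scale by `r`, add fresh noise of variance `s ^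
  -- 2`, insert `G₁`.
  let K : Kernel (C × Seq n) (Seq n) :=
    (Kernel.id ×ₖ Kernel.const _ (noiseLaw n)).map
      fun q => G₁ q.1.1 + r • (q.1.2 - G₂ q.1.1) + s • q.2
  have hKm : Measurable fun q : (C × Seq n) × Seq n =>
      G₁ q.1.1 + r • (q.1.2 - G₂ q.1.1) + s • q.2 := by fun_prop
  have : IsMarkovKernel K := Kernel.IsMarkovKernel.map _ hKm
  refine condMutualInfo_le_of_channel hX (by fun_prop) hW hX (by fun_prop) hW K fun f hf => ?_
  have hK : ∀ w x y, ∫⁻ y', f (w, x, y') ∂K (w, y) =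
      ∫⁻ v, f (w, x, G₁ w + r • (y - G₂ w) + s • v) ∂noiseLaw n := by
    intro w x y
    rw [Kernel.lintegral_map _ hKm _ (by fun_prop), Kernel.lintegral_prod _ _ _ (by fun_prop),
      Kernel.lintegral_id' (by fun_prop)]
    rfl
  -- After the offsets cancel, the signal is `r * b = a` times `x` and the noise is `r • z + s • v`,
  -- which is again white.
  have hl : ∀ w x, ∫⁻ z, f (w, x, a • x + G₁ w + z) ∂noiseLaw n =
      ∫⁻ z, ∫⁻ v, f (w, x, G₁ w + r • (b • x + G₂ w + z - G₂ w) + s • v)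
        ∂noiseLaw n ∂noiseLaw n := by
    intro w x
    conv_lhs => rw [← noiseLaw_prod_map_linear n hs]
    rw [lintegral_map (by fun_prop) (by fun_prop), lintegral_prod _ (by fun_prop)]
    refine lintegral_congr fun z => lintegral_congr fun v => ?_
    congr 3
    rw [hr]
    ext j
    simp
    ring
  simp only [hK]
  have e₁ : ∫⁻ ω, f (W ω, X ω, a • X ω + G₁ (W ω) + N₁ ω) ∂μ =
      ∫⁻ q : (C × Seq n) × Seq n, f (q.1.1, q.1.2, a • q.1.2 + G₁ q.1.1 + q.2)
        ∂(μ.map fun ω => ((W ω, X ω), N₁ ω)) := by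
    rw [lintegral_map (by fun_prop) (by fun_prop)]
  have hm : Measurable fun q : (C × Seq n) × Seq n =>
      ∫⁻ v, f (q.1.1, q.1.2, G₁ q.1.1 + r • (b • q.1.2 + G₂ q.1.1 + q.2 - G₂ q.1.1) + s • v)
        ∂noiseLaw n :=
    Measurable.lintegral_prod_right' (f := fun p : ((C × Seq n) × Seq n) × Seq n =>
      f (p.1.1.1, p.1.1.2,
        G₁ p.1.1.1 + r • (b • p.1.1.2 + G₂ p.1.1.1 + p.1.2 - G₂ p.1.1.1) + s • p.2)) (by fun_prop)
  have e₂ : ∫⁻ ω, ∫⁻ v, f (W ω, X ω, G₁ (W ω) +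
        r • (b • X ω + G₂ (W ω) + N₂ ω - G₂ (W ω)) + s • v) ∂noiseLaw n ∂μ =
      ∫⁻ q : (C × Seq n) × Seq n, ∫⁻ v, f (q.1.1, q.1.2,
        G₁ q.1.1 + r • (b • q.1.2 + G₂ q.1.1 + q.2 - G₂ q.1.1) + s • v) ∂noiseLaw n
        ∂(μ.map fun ω => ((W ω, X ω), N₂ ω)) := by
    rw [lintegral_map hm (by fun_prop)]
  rw [e₁, e₂, h₁, h₂, lintegral_prod _ (by fun_prop), lintegral_prod _ hm.aemeasurable]
  exact lintegral_congr fun p => hl p.1 p.2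

end GaussianIRC

/-! ### Conditional mutual information in the Gaussian case. -/

/-- For independent standard normal `x`, `z`, the observation `h x + z` and the error of the best
linear estimate of `x` from it are independent. -/
theorem gaussianReal_prod_map_rotation (h : ℝ) :
    ((gaussianReal 0 1).prod (gaussianReal 0 1)).map
        (fun p => (h * p.1 + p.2, p.1 - h / (h ^ 2 + 1) * (h * p.1 + p.2))) =
      (gaussianReal 0 (Real.toNNReal (h ^ 2 + 1))).prod
        (gaussianReal 0 (Real.toNNReal (1 / (h ^ 2 + 1)))) := by
  have hpos : 0 < h ^ 2 + 1 := by positivity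
  set P := (gaussianReal 0 1).prod (gaussianReal 0 1) with hP
  set V : ℝ × ℝ → ℝ := fun p => h * p.1 + p.2 with hV
  set U : ℝ × ℝ → ℝ := fun p => p.1 - h / (h ^ 2 + 1) * (h * p.1 + p.2) with hU
  have mV : P.map V = gaussianReal 0 (Real.toNNReal (h ^ 2 + 1)) := by
    have := gaussianReal_prod_map_linear h 1 1 1 (Real.toNNReal (h ^ 2 + 1))
      (by rw [Real.coe_toNNReal _ hpos.le]; simp)
    simpa using this
  -- The error equals `(x - h z) / (h ^ 2 + 1)`, of variance `(1 + h ^ 2) / (h ^ 2 + 1) ^ 2`.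
  have mU : P.map U = gaussianReal 0 (Real.toNNReal (1 / (h ^ 2 + 1))) := by
    rw [← gaussianReal_prod_map_linear (1 / (h ^ 2 + 1)) (-h / (h ^ 2 + 1)) 1 1
      (Real.toNNReal (1 / (h ^ 2 + 1)))
      (by rw [Real.coe_toNNReal _ (by positivity)]; push_cast; field_simp; ring)]
    congr 1
    ext p
    simp only [hU]
    field_simp
    ring
  have hfst : P.map Prod.fst = gaussianReal 0 1 := by simp [hP, Measure.map_fst_prod]
  have hsnd : P.map Prod.snd = gaussianReal 0 1 := by simp [hP, Measure.map_snd_prod]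
  -- The pair is a linear image of a Gaussian pair, so vanishing covariance will suffice for
  -- independence.
  have hG : HasGaussianLaw (fun p => (V p, U p)) P := by
    have h0 : IndepFun (Prod.fst : ℝ × ℝ → ℝ) Prod.snd P :=
      indepFun_prod measurable_id measurable_id
    have g1 : HasGaussianLaw (Prod.fst : ℝ × ℝ → ℝ) P := ⟨by rw [hfst]; infer_instance⟩
    have g2 : HasGaussianLaw (Prod.snd : ℝ × ℝ → ℝ) P := ⟨by rw [hsnd]; infer_instance⟩
    have := h0.hasGaussianLaw g1 g2
    let L : ℝ × ℝ →L[ℝ] ℝ × ℝ :=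
      ((h • ContinuousLinearMap.fst ℝ ℝ ℝ + ContinuousLinearMap.snd ℝ ℝ ℝ).prod
        (ContinuousLinearMap.fst ℝ ℝ ℝ - (h / (h ^ 2 + 1)) •
          (h • ContinuousLinearMap.fst ℝ ℝ ℝ + ContinuousLinearMap.snd ℝ ℝ ℝ)))
    exact this.map_fun L
  have m1 : MemLp (Prod.fst : ℝ × ℝ → ℝ) 2 P := by
    have := memLp_id_gaussianReal' (μ := 0) (v := 1) 2 (by simp)
    rw [← hfst] at this
    exact this.comp_of_map (by fun_prop)
  have m2 : MemLp (Prod.snd : ℝ × ℝ → ℝ) 2 P := by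
    have := memLp_id_gaussianReal' (μ := 0) (v := 1) 2 (by simp)
    rw [← hsnd] at this
    exact this.comp_of_map (by fun_prop)
  have c11 : cov[(Prod.fst : ℝ × ℝ → ℝ), Prod.fst; P] = 1 := by
    rw [covariance_self (by fun_prop), ← variance_id_map (by fun_prop), hfst]
    simp
  have c22 : cov[(Prod.snd : ℝ × ℝ → ℝ), Prod.snd; P] = 1 := by
    rw [covariance_self (by fun_prop), ← variance_id_map (by fun_prop), hsnd]
    simp
  have c12 : cov[(Prod.fst : ℝ × ℝ → ℝ), Prod.snd; P] = 0 :=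
    (indepFun_prod measurable_id measurable_id :
      IndepFun (Prod.fst : ℝ × ℝ → ℝ) Prod.snd P).covariance_eq_zero m1 m2
  have hcov : cov[V, U; P] = 0 := by
    have eV : V = h • Prod.fst + Prod.snd := rfl
    have eU : U = (1 / (h ^ 2 + 1)) • Prod.fst + (-h / (h ^ 2 + 1)) • Prod.snd := by
      ext p
      simp only [hU, Pi.add_apply, Pi.smul_apply, smul_eq_mul]
      field_simp
      ring
    rw [eV, eU, covariance_add_left (m1.const_smul _) m2
        ((m1.const_smul _).add (m2.const_smul _)),
      covariance_add_right (m1.const_smul _) (m1.const_smul _) (m2.const_smul _),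
      covariance_add_right m2 (m1.const_smul _) (m2.const_smul _)]
    simp only [covariance_smul_left, covariance_smul_right, c11, c22, c12,
      covariance_comm Prod.snd Prod.fst]
    field_simp
    ring
  have hind := hG.indepFun_of_covariance_eq_zero hcov
  rw [indepFun_iff_map_prod_eq_prod_map_map (by fun_prop) (by fun_prop), mV, mU] at hind
  exact hind

theorem integrable_sq_of_map_eq_gaussianReal {Ω : Type*} [MeasurableSpace Ω] {μ : Measure Ω}
    {X : Ω → ℝ} {v : NNReal} (hX : Measurable X) (h : μ.map X = gaussianReal 0 v) :
    Integrable (fun ω => X ω ^ 2) μ := by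
  have := memLp_id_gaussianReal' (μ := 0) (v := v) 2 (by simp)
  rw [← h] at this
  exact (this.comp_of_map (by fun_prop)).integrable_sq

theorem integral_sq_of_map_eq_gaussianReal {Ω : Type*} [MeasurableSpace Ω] {μ : Measure Ω}
    {X : Ω → ℝ} {v : NNReal} (hX : Measurable X) (h : μ.map X = gaussianReal 0 v) :
    ∫ ω, X ω ^ 2 ∂μ = v := by
  rw [← variance_id_gaussianReal (μ := 0) (v := v), variance_eq_integral (by fun_prop), ← h,
    integral_map (by fun_prop) (by fun_prop)]
  have : ∫ x, x ∂(μ.map X) = 0 := by rw [h]; exact integral_id_gaussianReal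
  simp [this]

theorem lintegral_const_add_gaussianReal {F : ℝ → ℝ≥0∞} (hF : Measurable F) (c : ℝ) {v : NNReal}
    (hv : v ≠ 0) :
    ∫⁻ z, F (c + z) ∂gaussianReal 0 v = ∫⁻ y, gaussianPDF 0 v (y - c) * F y := by
  rw [gaussianReal_of_var_ne_zero _ hv,
    lintegral_withDensity_eq_lintegral_mul _ (by fun_prop) (by fun_prop),
    ← lintegral_add_right_eq_self (fun y => gaussianPDF 0 v (y - c) * F y) c]
  refine lintegral_congr fun z => ?_
  simp [add_comm]

theorem log_gaussianPDFReal_zero {v : NNReal} (hv : v ≠ 0) (x : ℝ) :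
    Real.log (gaussianPDFReal 0 v x) =
      -(Real.log (2 * Real.pi * v)) / 2 - x ^ 2 / (2 * v) := by
  have : (0 : ℝ) < v := by positivity
  rw [gaussianPDFReal, Real.log_mul (by positivity) (by positivity), Real.log_inv,
    Real.log_sqrt (by positivity), Real.log_exp]
  simp
  ring

/-- The conditional mutual information across an additive white Gaussian noise channel of gain `a`,
when the input is Gaussian of variance `s` given the conditioning variable. -/
theorem condMutualInfo_gaussian {C : Type*} [MeasurableSpace C] (ρ : Measure C)
    [IsProbabilityMeasure ρ] {m g : C → ℝ} (hm : Measurable m) (hg : Measurable g) (a : ℝ)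
    (s : NNReal) :
    condMutualInfo (ρ.prod ((gaussianReal 0 s).prod (gaussianReal 0 1)))
      (fun p => m p.1 + p.2.1) (fun p => a * (m p.1 + p.2.1) + g p.1 + p.2.2) (fun p => p.1) =
      ENNReal.ofReal (Real.log (a ^ 2 * s + 1) / 2) := by
  set μ := ρ.prod ((gaussianReal 0 s).prod (gaussianReal 0 1)) with hμ
  -- `v` is the variance of `a u + z`, the random part of the output given the conditioning
  -- variable.
  obtain ⟨v, hv⟩ : ∃ v : NNReal, (v : ℝ) = a ^ 2 * s + 1 :=
    ⟨⟨a ^ 2 * s + 1, by positivity⟩, rfl⟩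
  have hvpos : (0 : ℝ) < v := by rw [hv]; positivity
  have hv0 : v ≠ 0 := fun h => by simp [h] at hvpos
  let κ : Kernel C ℝ := (Kernel.id ×ₖ Kernel.const _ (gaussianReal 0 s)).map fun q => m q.1 + q.2
  let η : Kernel C ℝ := (Kernel.id ×ₖ Kernel.const _ (gaussianReal 0 v)).map
    fun q => a * m q.1 + g q.1 + q.2
  have : IsMarkovKernel κ := Kernel.IsMarkovKernel.map _ (by fun_prop)
  have : IsMarkovKernel η := Kernel.IsMarkovKernel.map _ (by fun_prop)
  have hκ : ∀ w (f : ℝ → ℝ≥0∞), Measurable f →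
      ∫⁻ x, f x ∂κ w = ∫⁻ u, f (m w + u) ∂gaussianReal 0 s := by
    intro w f hf
    rw [Kernel.lintegral_map _ (by fun_prop) _ hf, Kernel.lintegral_prod _ _ _ (by fun_prop),
      Kernel.lintegral_id' (by fun_prop)]
    rfl
  have hη : ∀ w (f : ℝ → ℝ≥0∞), Measurable f →
      ∫⁻ x, f x ∂η w = ∫⁻ u, f (a * m w + g w + u) ∂gaussianReal 0 v := by
    intro w f hf
    rw [Kernel.lintegral_map _ (by fun_prop) _ hf, Kernel.lintegral_prod _ _ _ (by fun_prop),
      Kernel.lintegral_id' (by fun_prop)]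
    rfl
  have hμl : ∀ f : C × ℝ × ℝ → ℝ≥0∞, Measurable f → ∫⁻ p, f p ∂μ =
      ∫⁻ w, ∫⁻ u, ∫⁻ z, f (w, u, z) ∂gaussianReal 0 1 ∂gaussianReal 0 s ∂ρ := by
    intro f hf
    rw [hμ, lintegral_prod _ hf.aemeasurable]
    refine lintegral_congr fun w => ?_
    rw [lintegral_prod _ (by fun_prop)]
  have hρ : μ.map (fun p => p.1) = ρ := by simp [hμ, Measure.map_fst_prod]
  have hnoise : ((gaussianReal 0 s).prod (gaussianReal 0 1)).map (fun p => a * p.1 + p.2) =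
      gaussianReal 0 v := by
    simpa using gaussianReal_prod_map_linear a 1 s 1 v (by simp [hv])
  have hX : μ.map (fun p => (p.1, m p.1 + p.2.1)) = μ.map (fun p => p.1) ⊗ₘ κ := by
    rw [hρ]
    refine Measure.ext_of_lintegral _ fun f hf => ?_
    rw [lintegral_map hf (by fun_prop), hμl _ (by fun_prop), Measure.lintegral_compProd hf]
    refine lintegral_congr fun w => ?_
    rw [hκ _ _ (by fun_prop)]
    simp
  have hY : μ.map (fun p => (p.1, a * (m p.1 + p.2.1) + g p.1 + p.2.2)) =
      μ.map (fun p => p.1) ⊗ₘ η := by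
    rw [hρ]
    refine Measure.ext_of_lintegral _ fun f hf => ?_
    rw [lintegral_map hf (by fun_prop), hμl _ (by fun_prop), Measure.lintegral_compProd hf]
    refine lintegral_congr fun w => ?_
    rw [hη _ _ (by fun_prop), ← hnoise, lintegral_map (by fun_prop) (by fun_prop),
      lintegral_prod _ (by fun_prop)]
    refine lintegral_congr fun u => lintegral_congr fun z => ?_
    congr 2
    ring
  rw [condMutualInfo_eq_klDiv_of_compProd (by fun_prop) (by fun_prop) hX hY, hρ]
  set P := μ.map fun p => (p.1, m p.1 + p.2.1, a * (m p.1 + p.2.1) + g p.1 + p.2.2) with hP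
  set Q := ρ ⊗ₘ (κ ×ₖ η) with hQ
  -- The density of the output given input and conditioning variable, over its density given the
  -- conditioning variable alone. The input has the same law `κ` under `P` and `Q`, so it needs no
  -- density and `s = 0` is allowed.
  let r : C × ℝ × ℝ → ℝ≥0∞ := fun q =>
    gaussianPDF 0 1 (q.2.2 - (a * q.2.1 + g q.1)) / gaussianPDF 0 v (q.2.2 - (a * m q.1 + g q.1))
  have hr : Measurable r := by fun_prop
  have hPQ : P = Q.withDensity r := by
    refine Measure.ext_of_lintegral _ fun f hf => ?_
    rw [lintegral_withDensity_eq_lintegral_mul _ hr hf, hP, lintegral_map hf (by fun_prop),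
      hμl _ (by fun_prop), hQ, Measure.lintegral_compProd (by fun_prop)]
    refine lintegral_congr fun w => ?_
    rw [Kernel.lintegral_prod _ _ _ (by fun_prop), hκ _ _ (by fun_prop)]
    refine lintegral_congr fun u => ?_
    dsimp only
    rw [hη _ _ (by fun_prop), lintegral_const_add_gaussianReal
        (F := fun y => (r * f) (w, m w + u, y)) (by fun_prop) _ hv0,
      lintegral_const_add_gaussianReal (F := fun y => f (w, m w + u, y)) (by fun_prop) _
        one_ne_zero]
    refine lintegral_congr fun y => ?_
    simp only [r, Pi.mul_apply]
    rw [← mul_assoc, ENNReal.mul_div_cancel (gaussianPDF_pos _ hv0 _).ne' gaussianPDF_ne_top]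
  have hac : P ≪ Q := hPQ ▸ withDensity_absolutelyContinuous _ _
  have : IsProbabilityMeasure P := Measure.isProbabilityMeasure_map (by fun_prop)
  have hllr : llr P Q =ᵐ[P] fun q => Real.log v / 2 -
      (q.2.2 - (a * q.2.1 + g q.1)) ^ 2 / 2 +
        (q.2.2 - (a * m q.1 + g q.1)) ^ 2 / (2 * v) := by
    have h1 : P.rnDeriv Q =ᵐ[P] r := by
      refine hac.ae_eq ?_
      conv_lhs => rw [hPQ]
      exact Measure.rnDeriv_withDensity Q hr
    filter_upwards [h1] with q hq
    rw [llr, hq]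
    simp only [r]
    rw [ENNReal.toReal_div, toReal_gaussianPDF, toReal_gaussianPDF,
      Real.log_div (gaussianPDFReal_pos _ _ _ one_ne_zero).ne' (gaussianPDFReal_pos _ _ _ hv0).ne',
      log_gaussianPDFReal_zero one_ne_zero, log_gaussianPDFReal_zero hv0,
      Real.log_mul (by positivity) hvpos.ne']
    simp
    ring
  have hmap1 : μ.map (fun p => p.2.2) = gaussianReal 0 1 := by
    have : (fun p : C × ℝ × ℝ => p.2.2) = Prod.snd ∘ Prod.snd := rfl
    rw [this, ← Measure.map_map (by fun_prop) (by fun_prop), hμ, Measure.map_snd_prod,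
      measure_univ, one_smul, Measure.map_snd_prod, measure_univ, one_smul]
  have hmap2 : μ.map (fun p => a * p.2.1 + p.2.2) = gaussianReal 0 v := by
    have : (fun p : C × ℝ × ℝ => a * p.2.1 + p.2.2) = (fun p => a * p.1 + p.2) ∘ Prod.snd := rfl
    rw [this, ← Measure.map_map (by fun_prop) (by fun_prop), hμ, Measure.map_snd_prod,
      measure_univ, one_smul, hnoise]
  have i1 := integrable_sq_of_map_eq_gaussianReal (by fun_prop) hmap1
  have i2 := integrable_sq_of_map_eq_gaussianReal (by fun_prop) hmap2
  -- On the sample space the two squares are those of `z` and `a u + z`, with means `1` and `v`. The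
  -- quadratic terms thus contribute `-1 / 2 + v / (2 * v) = 0`, and only `log v / 2` survives.
  have hcomp : ∀ p : C × ℝ × ℝ, Real.log v / 2 -
      (a * (m p.1 + p.2.1) + g p.1 + p.2.2 - (a * (m p.1 + p.2.1) + g p.1)) ^ 2 / 2 +
        (a * (m p.1 + p.2.1) + g p.1 + p.2.2 - (a * m p.1 + g p.1)) ^ 2 / (2 * v) =
      Real.log v / 2 - p.2.2 ^ 2 / 2 + (a * p.2.1 + p.2.2) ^ 2 / (2 * v) := by
    intro p
    ring
  have hint : Integrable (llr P Q) P := by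
    rw [integrable_congr hllr, hP, integrable_map_measure (by fun_prop) (by fun_prop)]
    simp only [Function.comp_def, hcomp]
    exact ((integrable_const _).sub (i1.div_const _)).add (i2.div_const _)
  rw [InformationTheory.klDiv_of_ac_of_integrable hac hint, integral_congr_ae hllr]
  conv_lhs => rw [hP]
  rw [integral_map (by fun_prop) (by fun_prop)]
  simp only [hcomp]
  have i3 : Integrable (fun p : C × ℝ × ℝ => Real.log v / 2 - p.2.2 ^ 2 / 2) μ :=
    (integrable_const _).sub (i1.div_const _)
  rw [integral_add i3 (i2.div_const _),
    integral_sub (integrable_const _) (i1.div_const _), integral_div, integral_div, integral_div,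
    integral_sq_of_map_eq_gaussianReal (by fun_prop) hmap1,
    integral_sq_of_map_eq_gaussianReal (by fun_prop) hmap2, ← hP, ← hv]
  congr 1
  simp
  field_simp
  ring

/-- The conditional mutual information between a standard normal input `x` and `a x + z` given the
observation `h x + z'` (embedded in `C` by `e`), with independent standard normal noises. -/
theorem condMutualInfo_gaussian_side_observation {C : Type*} [MeasurableSpace C] {e : ℝ → C}
    {π : C → ℝ} (he : Measurable e) (hπ : Measurable π) (hπe : ∀ y, π (e y) = y) (h a : ℝ) :
    condMutualInfo (((gaussianReal 0 1).prod (gaussianReal 0 1)).prod (gaussianReal 0 1))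
      (fun p => p.1.1) (fun p => a * p.1.1 + p.2) (fun p => e (h * p.1.1 + p.1.2)) =
      ENNReal.ofReal (Real.log (a ^ 2 * (1 / (h ^ 2 + 1)) + 1) / 2) := by
  set s := Real.toNNReal (1 / (h ^ 2 + 1)) with hs
  have hs' : (s : ℝ) = 1 / (h ^ 2 + 1) := Real.coe_toNNReal _ (by positivity)
  set τ := Real.toNNReal (h ^ 2 + 1)
  have hρ : IsProbabilityMeasure ((gaussianReal 0 τ).map e) :=
    Measure.isProbabilityMeasure_map he.aemeasurable
  -- Given the observation `y`, the input is the estimate `h / (h ^ 2 + 1) * y` plus an independent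
  -- error of variance `s`; `π` reads `y` off the conditioning variable.
  rw [← hs', ← condMutualInfo_gaussian ((gaussianReal 0 τ).map e)
    (m := fun w => h / (h ^ 2 + 1) * π w) (g := fun _ => 0) (by fun_prop) (by fun_prop) a s]
  refine condMutualInfo_congr_map (by fun_prop) (by fun_prop) (by fun_prop) (by fun_prop)
    (by fun_prop) (by fun_prop) ?_
  refine Measure.ext_of_lintegral _ fun f hf => ?_
  rw [lintegral_map hf (by fun_prop), lintegral_map hf (by fun_prop),
    lintegral_prod _ (by fun_prop), lintegral_prod (μ := (gaussianReal 0 τ).map e) _ (by fun_prop)]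
  dsimp only
  have hF : Measurable fun q : ℝ × ℝ => ∫⁻ z, f (e q.1, h / (h ^ 2 + 1) * q.1 + q.2,
      a * (h / (h ^ 2 + 1) * q.1 + q.2) + z) ∂gaussianReal 0 1 :=
    Measurable.lintegral_prod_right' (f := fun q : (ℝ × ℝ) × ℝ =>
      f (e q.1.1, h / (h ^ 2 + 1) * q.1.1 + q.1.2, a * (h / (h ^ 2 + 1) * q.1.1 + q.1.2) + q.2))
      (by fun_prop)
  have hG : Measurable fun w : C => ∫⁻ q : ℝ × ℝ, f (w, h / (h ^ 2 + 1) * π w + q.1,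
      a * (h / (h ^ 2 + 1) * π w + q.1) + 0 + q.2)
        ∂(gaussianReal 0 s).prod (gaussianReal 0 1) :=
    Measurable.lintegral_prod_right' (f := fun q : C × ℝ × ℝ =>
      f (q.1, h / (h ^ 2 + 1) * π q.1 + q.2.1,
        a * (h / (h ^ 2 + 1) * π q.1 + q.2.1) + 0 + q.2.2)) (by fun_prop)
  -- Change of variables from input and noise to observation and estimation error.
  have hrot := congrArg (fun ν => ∫⁻ q : ℝ × ℝ, ∫⁻ z, f (e q.1, h / (h ^ 2 + 1) * q.1 + q.2,
      a * (h / (h ^ 2 + 1) * q.1 + q.2) + z) ∂gaussianReal 0 1 ∂ν)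
    (gaussianReal_prod_map_rotation h)
  beta_reduce at hrot
  rw [lintegral_map hF (by fun_prop), lintegral_prod _ hF.aemeasurable] at hrot
  simp only [add_sub_cancel] at hrot
  rw [hrot, lintegral_map hG he]
  refine lintegral_congr fun y => ?_
  rw [lintegral_prod _ (by fun_prop)]
  simp only [hπe, add_zero]
  rfl

/-- The logarithms are nonnegative, so `ENNReal.ofReal` loses nothing; monotonicity of `log` and `0
< t` leave `a ^ 2 ≤ b ^ 2`. -/
theorem abs_le_abs_of_log_gain_le {a b t : ℝ} (ht : 0 < t)
    (h : ENNReal.ofReal (Real.log (a ^ 2 * t + 1) / 2) ≤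
      ENNReal.ofReal (Real.log (b ^ 2 * t + 1) / 2)) : |a| ≤ |b| := by
  have hb : 0 ≤ b ^ 2 * t := by positivity
  rw [ENNReal.ofReal_le_ofReal_iff (div_nonneg (Real.log_nonneg (by linarith)) (by norm_num)),
    div_le_div_iff_of_pos_right (by norm_num),
    Real.log_le_log_iff (by positivity) (by positivity), add_le_add_iff_right,
    mul_le_mul_iff_left₀ ht] at h
  exact sq_le_sq.1 h

/-! ### Gain inequalities from strong interference. -/

namespace GaussianIRC

/-- With source 2 and the relay sending zero, only `X1` and the three noises remain random, and the
kernel disappears from the law. -/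
theorem useLaw_dirac_right (c : GaussianIRC) (μ : Measure ℝ) [IsProbabilityMeasure μ] :
    c.useLaw μ (Measure.dirac 0) (Kernel.const _ (Measure.dirac 0)) =
      ((μ.prod (gaussianReal 0 1)).prod ((gaussianReal 0 1).prod (gaussianReal 0 1))).map
        fun p => (((p.1.1, 0, p.1.2), 0), p.2) := by
  refine Measure.ext_of_lintegral _ fun f hf => ?_
  have hm : Measurable fun p : ℝ × ℝ × ℝ =>
      ∫⁻ z, f ((p, 0), z) ∂(gaussianReal 0 1).prod (gaussianReal 0 1) :=
    Measurable.lintegral_prod_right' (f := fun q : (ℝ × ℝ × ℝ) × ℝ × ℝ => f ((q.1, 0), q.2))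
      (by fun_prop)
  have hm' : Measurable fun p : ℝ × ℝ =>
      ∫⁻ z, f (((p.1, 0, p.2), 0), z) ∂(gaussianReal 0 1).prod (gaussianReal 0 1) :=
    hm.comp (by fun_prop : Measurable fun p : ℝ × ℝ => (p.1, (0 : ℝ), p.2))
  rw [lintegral_map hf (by fun_prop), useLaw, lintegral_prod _ hf.aemeasurable,
    lintegral_prod _ (by fun_prop), Measure.lintegral_compProd hf.lintegral_prod_right']
  simp only [Kernel.comap_apply, Kernel.const_apply, lintegral_dirac]
  rw [lintegral_prod _ hm.aemeasurable, lintegral_prod _ hm'.aemeasurable]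
  refine lintegral_congr fun x => ?_
  have hx : Measurable fun p : ℝ × ℝ =>
      ∫⁻ z, f (((x, p), 0), z) ∂(gaussianReal 0 1).prod (gaussianReal 0 1) :=
    hm.comp measurable_prodMk_left
  rw [lintegral_prod _ hx.aemeasurable, lintegral_dirac]

theorem useLaw_dirac_left (c : GaussianIRC) (μ : Measure ℝ) [IsProbabilityMeasure μ] :
    c.useLaw (Measure.dirac 0) μ (Kernel.const _ (Measure.dirac 0)) =
      ((μ.prod (gaussianReal 0 1)).prod ((gaussianReal 0 1).prod (gaussianReal 0 1))).map
        fun p => (((0, p.1.1, p.1.2), 0), p.2) := by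
  refine Measure.ext_of_lintegral _ fun f hf => ?_
  have hm : Measurable fun p : ℝ × ℝ × ℝ =>
      ∫⁻ z, f ((p, 0), z) ∂(gaussianReal 0 1).prod (gaussianReal 0 1) :=
    Measurable.lintegral_prod_right' (f := fun q : (ℝ × ℝ × ℝ) × ℝ × ℝ => f ((q.1, 0), q.2))
      (by fun_prop)
  rw [lintegral_map hf (by fun_prop), useLaw, lintegral_prod _ hf.aemeasurable,
    lintegral_prod _ (by fun_prop), Measure.lintegral_compProd hf.lintegral_prod_right']
  simp only [Kernel.comap_apply, Kernel.const_apply, lintegral_dirac]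
  rw [lintegral_prod _ hm.aemeasurable, lintegral_dirac]

@[fun_prop]
theorem measurable_useX1 : Measurable useX1 := by
  unfold useX1
  fun_prop

@[fun_prop]
theorem measurable_useX2 : Measurable useX2 := by
  unfold useX2
  fun_prop

@[fun_prop]
theorem measurable_useXR : Measurable useXR := by
  unfold useXR
  fun_prop

@[fun_prop]
theorem measurable_useYR (c : GaussianIRC) : Measurable c.useYR := by
  unfold useYR relayOut
  fun_prop

@[fun_prop]
theorem measurable_useY1 (c : GaussianIRC) : Measurable c.useY1 := by
  unfold useY1 out1 dotProduct
  fun_prop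

@[fun_prop]
theorem measurable_useY2 (c : GaussianIRC) : Measurable c.useY2 := by
  unfold useY2 out2 dotProduct
  fun_prop

/-- The noise of the destination not under consideration is integrated out. -/
theorem map_fst_noise :
    (((gaussianReal 0 1).prod (gaussianReal 0 1)).prod
      ((gaussianReal 0 1).prod (gaussianReal 0 1))).map (fun p => (p.1, p.2.1)) =
      ((gaussianReal 0 1).prod (gaussianReal 0 1)).prod (gaussianReal 0 1) := by
  have h := Measure.map_prod_map ((gaussianReal 0 1).prod (gaussianReal 0 1))
    ((gaussianReal 0 1).prod (gaussianReal 0 1)) measurable_id measurable_fst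
  rw [Measure.map_id, Measure.map_fst_prod, measure_univ, one_smul] at h
  exact h.symm

theorem map_snd_noise :
    (((gaussianReal 0 1).prod (gaussianReal 0 1)).prod
      ((gaussianReal 0 1).prod (gaussianReal 0 1))).map (fun p => (p.1, p.2.2)) =
      ((gaussianReal 0 1).prod (gaussianReal 0 1)).prod (gaussianReal 0 1) := by
  have h := Measure.map_prod_map ((gaussianReal 0 1).prod (gaussianReal 0 1))
    ((gaussianReal 0 1).prod (gaussianReal 0 1)) measurable_id measurable_snd
  rw [Measure.map_id, Measure.map_snd_prod, measure_univ, one_smul] at h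
  exact h.symm

/-- With a Gaussian input, no interference and a silent relay, the conditional mutual information
of the strong interference condition is that of a scalar Gaussian channel. -/
theorem condMutualInfo_useLaw {ν : Measure Use} [IsProbabilityMeasure ν]
    {T : (ℝ × ℝ) × ℝ × ℝ → Use} (hT : Measurable T)
    (hν : ν = (((gaussianReal 0 1).prod (gaussianReal 0 1)).prod
      ((gaussianReal 0 1).prod (gaussianReal 0 1))).map T)
    {X Y : Use → ℝ} {W : Use → ℝ × ℝ × (Fin 2 → ℝ)} {N : ℝ × ℝ → ℝ} {h a : ℝ}
    (hX : Measurable X) (hY : Measurable Y) (hW : Measurable W) (hN : Measurable N)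
    (hNlaw : (((gaussianReal 0 1).prod (gaussianReal 0 1)).prod
      ((gaussianReal 0 1).prod (gaussianReal 0 1))).map (fun p => (p.1, N p.2)) =
      ((gaussianReal 0 1).prod (gaussianReal 0 1)).prod (gaussianReal 0 1))
    (hXT : ∀ p, X (T p) = p.1.1) (hYT : ∀ p, Y (T p) = a * p.1.1 + N p.2)
    (hWT : ∀ p, W (T p) = (0, h * p.1.1 + p.1.2, 0)) :
    condMutualInfo ν X Y W =
      ENNReal.ofReal (Real.log (a ^ 2 * (1 / (h ^ 2 + 1)) + 1) / 2) := by
  rw [← condMutualInfo_gaussian_side_observation (C := ℝ × ℝ × (Fin 2 → ℝ))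
    (e := fun y => (0, y, 0)) (π := fun w => w.2.1) (by fun_prop) (by fun_prop) (fun _ => rfl) h a]
  refine condMutualInfo_congr_map hX hY hW (by fun_prop) (by fun_prop) (by fun_prop) ?_
  rw [hν, ← hNlaw, Measure.map_map (by fun_prop) hT, Measure.map_map (by fun_prop) (by fun_prop)]
  congr 1
  ext1 p
  simp only [Function.comp_apply, hXT, hYT, hWT]

/-- Test with a standard normal `X1`, `X2 = 0` and a silent relay. Both sides share the factor `1 /
(hR1 ^ 2 + 1)`, which is positive, so the comparison reduces to the gains. -/
theorem StrongInterference.abs_h11_le {c : GaussianIRC} (hc : c.StrongInterference) :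
    |c.h11| ≤ |c.h21| := by
  have h := (hc (gaussianReal 0 1) (Measure.dirac 0) (Kernel.const _ (Measure.dirac 0))).1
  rw [condMutualInfo_useLaw (by fun_prop) (c.useLaw_dirac_right _) (N := Prod.fst) (a := c.h11)
      (h := c.hR1) (by fun_prop) (by fun_prop) (by fun_prop) (by fun_prop) map_fst_noise
      (by simp [useX1]) (by simp [useX1, useX2, useXR, useY1, out1])
      (by simp [useX1, useX2, useXR, useYR, relayOut]),
    condMutualInfo_useLaw (by fun_prop) (c.useLaw_dirac_right _) (N := Prod.snd) (a := c.h21)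
      (h := c.hR1) (by fun_prop) (by fun_prop) (by fun_prop) (by fun_prop) map_snd_noise
      (by simp [useX1]) (by simp [useX1, useX2, useXR, useY2, out2])
      (by simp [useX1, useX2, useXR, useYR, relayOut])] at h
  exact abs_le_abs_of_log_gain_le (by positivity) h

theorem StrongInterference.abs_h22_le {c : GaussianIRC} (hc : c.StrongInterference) :
    |c.h22| ≤ |c.h12| := by
  have h := (hc (Measure.dirac 0) (gaussianReal 0 1) (Kernel.const _ (Measure.dirac 0))).2
  rw [condMutualInfo_useLaw (by fun_prop) (c.useLaw_dirac_left _) (N := Prod.snd) (a := c.h22)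
      (h := c.hR2) (by fun_prop) (by fun_prop) (by fun_prop) (by fun_prop) map_snd_noise
      (by simp [useX2]) (by simp [useX1, useX2, useXR, useY2, out2])
      (by simp [useX1, useX2, useXR, useYR, relayOut]),
    condMutualInfo_useLaw (by fun_prop) (c.useLaw_dirac_left _) (N := Prod.fst) (a := c.h12)
      (h := c.hR2) (by fun_prop) (by fun_prop) (by fun_prop) (by fun_prop) map_fst_noise
      (by simp [useX2]) (by simp [useX1, useX2, useXR, useY1, out1])
      (by simp [useX1, useX2, useXR, useYR, relayOut])] at h
  exact abs_le_abs_of_log_gain_le (by positivity) h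

end GaussianIRC

/-! ### Blocks of channel uses and the conclusion. -/

namespace GaussianIRC

variable {n : ℕ}

@[fun_prop]
theorem measurable_blockX1 : Measurable (blockX1 (n := n)) := by
  unfold blockX1
  fun_prop

@[fun_prop]
theorem measurable_blockX2 : Measurable (blockX2 (n := n)) := by
  unfold blockX2
  fun_prop

@[fun_prop]
theorem measurable_blockYR (c : GaussianIRC) : Measurable (c.blockYR (n := n)) := by
  unfold blockYR relayOut
  fun_prop

@[fun_prop]
theorem measurable_upTo (j : Fin n) : Measurable fun y : Seq n => upTo y j := by
  unfold upTo
  fun_prop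

/-- The noise of the first destination is independent of the inputs and of the relay's noise. -/
theorem blockLaw_map_noise1 (μ1 μ2 : Measure (Seq n)) [IsProbabilityMeasure μ1]
    [IsProbabilityMeasure μ2] :
    (blockLaw μ1 μ2).map (fun ω => ((ω.1, ω.2.1, ω.2.2.1), ω.2.2.2.1)) =
      (μ1.prod (μ2.prod (noiseLaw n))).prod (noiseLaw n) := by
  refine Measure.ext_of_lintegral _ fun f hf => ?_
  rw [lintegral_map hf (by fun_prop), blockLaw, lintegral_prod _ (by fun_prop),
    lintegral_prod _ hf.aemeasurable, lintegral_prod _ (by fun_prop)]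
  refine lintegral_congr fun x => ?_
  rw [lintegral_prod _ (by fun_prop), lintegral_prod _ (by fun_prop)]
  refine lintegral_congr fun y => ?_
  rw [lintegral_prod _ (by fun_prop)]
  refine lintegral_congr fun z => ?_
  rw [lintegral_prod _ (by fun_prop)]
  simp

theorem blockLaw_map_noise2 (μ1 μ2 : Measure (Seq n)) [IsProbabilityMeasure μ1]
    [IsProbabilityMeasure μ2] :
    (blockLaw μ1 μ2).map (fun ω => ((ω.1, ω.2.1, ω.2.2.1), ω.2.2.2.2)) =
      (μ1.prod (μ2.prod (noiseLaw n))).prod (noiseLaw n) := by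
  refine Measure.ext_of_lintegral _ fun f hf => ?_
  rw [lintegral_map hf (by fun_prop), blockLaw, lintegral_prod _ (by fun_prop),
    lintegral_prod _ hf.aemeasurable, lintegral_prod _ (by fun_prop)]
  refine lintegral_congr fun x => ?_
  rw [lintegral_prod _ (by fun_prop), lintegral_prod _ (by fun_prop)]
  refine lintegral_congr fun y => ?_
  rw [lintegral_prod _ (by fun_prop)]
  refine lintegral_congr fun z => ?_
  rw [lintegral_prod _ (by fun_prop)]
  simp

/-- A variable independent of `V` is independent of every function of `V`. -/
theorem map_prodMk_of_map_prodMk {Ω V E N : Type*} [MeasurableSpace Ω] [MeasurableSpace V]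
    [MeasurableSpace E] [MeasurableSpace N] {μ : Measure Ω} {ν : Measure N} {lam : Measure V}
    [IsProbabilityMeasure ν] [IsProbabilityMeasure lam] {v : Ω → V} {w : Ω → N} {g : V → E}
    (hv : Measurable v) (hw : Measurable w) (hg : Measurable g)
    (h : μ.map (fun ω => (v ω, w ω)) = lam.prod ν) :
    μ.map (fun ω => (g (v ω), w ω)) = (μ.map fun ω => g (v ω)).prod ν := by
  have h1 : μ.map v = lam := by
    have := congrArg (fun ρ => ρ.map Prod.fst) h
    beta_reduce at this
    rwa [Measure.map_map (by fun_prop) (by fun_prop), Measure.map_fst_prod, measure_univ,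
      one_smul] at this
  have h2 : μ.map (fun ω => g (v ω)) = lam.map g := by
    rw [← h1, Measure.map_map hg hv]
    rfl
  rw [h2]
  have h3 := congrArg (fun ρ => ρ.map (Prod.map g id)) h
  beta_reduce at h3
  rwa [Measure.map_map (by fun_prop) (by fun_prop), ← Measure.map_prod_map _ _ hg measurable_id,
    Measure.map_id] at h3

end GaussianIRC

theorem lemma2 (c : GaussianIRC) (hc : c.StrongInterference) (n : ℕ) (hn : 1 ≤ n)
    (μ1 μ2 : Measure (GaussianIRC.Seq n)) [IsProbabilityMeasure μ1] [IsProbabilityMeasure μ2]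
    (f : GaussianIRC.RelayFun n) (hf : ∀ j, Measurable (f j)) :
    condMutualInfo (GaussianIRC.blockLaw μ1 μ2) GaussianIRC.blockX1 (c.blockY1 f)
        (fun ω => (GaussianIRC.blockX2 ω, c.blockYR ω))
      ≤ condMutualInfo (GaussianIRC.blockLaw μ1 μ2) GaussianIRC.blockX1 (c.blockY2 f)
          (fun ω => (GaussianIRC.blockX2 ω, c.blockYR ω)) ∧
    condMutualInfo (GaussianIRC.blockLaw μ1 μ2) GaussianIRC.blockX2 (c.blockY2 f)
        (fun ω => (GaussianIRC.blockX1 ω, c.blockYR ω))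
      ≤ condMutualInfo (GaussianIRC.blockLaw μ1 μ2) GaussianIRC.blockX2 (c.blockY1 f)
          (fun ω => (GaussianIRC.blockX1 ω, c.blockYR ω)) := by
  -- The offset known to the conditioning: the other source's contribution and the relay's signal,
  -- which is recomputed from the relay's received sequence `w.2`.
  have hG : ∀ (h : ℝ) (k : Fin 2 → ℝ), Measurable fun w : GaussianIRC.Seq n × GaussianIRC.Seq n =>
      (fun j => h * w.1 j + k ⬝ᵥ f j (GaussianIRC.upTo w.2 j) : GaussianIRC.Seq n) := by
    intro h k
    simp only [dotProduct, Fin.sum_univ_two]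
    have : ∀ j (i : Fin 2), Measurable fun w : GaussianIRC.Seq n × GaussianIRC.Seq n =>
        f j (GaussianIRC.upTo w.2 j) i := fun j i =>
      (measurable_pi_apply i).comp ((hf j).comp ((GaussianIRC.measurable_upTo j).comp measurable_snd))
    fun_prop
  have hYR : Measurable fun v : GaussianIRC.Seq n × GaussianIRC.Seq n × GaussianIRC.Seq n =>
      (fun j => c.relayOut (v.1 j) (v.2.1 j) (v.2.2 j) : GaussianIRC.Seq n) := by
    unfold GaussianIRC.relayOut
    fun_prop
  constructor
  · have key := GaussianIRC.condMutualInfo_le_of_abs_gain_le hc.abs_h11_le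
      GaussianIRC.measurable_blockX1
      (by fun_prop : Measurable fun ω : GaussianIRC.Block n => ω.2.2.2.1)
      (by fun_prop : Measurable fun ω : GaussianIRC.Block n => ω.2.2.2.2)
      (by fun_prop : Measurable fun ω => (GaussianIRC.blockX2 ω, c.blockYR ω))
      (hG c.h12 c.h1R) (hG c.h22 c.h2R)
      -- The conditioning pair and the input are functions of the inputs and the relay's noise, all
      -- independent of the destination's noise.
      (GaussianIRC.map_prodMk_of_map_prodMk (by fun_prop) (by fun_prop)
        (g := fun v => ((v.2.1, fun j => c.relayOut (v.1 j) (v.2.1 j) (v.2.2 j)), v.1))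
        ((measurable_snd.fst.prodMk hYR).prodMk measurable_fst)
        (GaussianIRC.blockLaw_map_noise1 μ1 μ2))
      (GaussianIRC.map_prodMk_of_map_prodMk (by fun_prop) (by fun_prop)
        (g := fun v => ((v.2.1, fun j => c.relayOut (v.1 j) (v.2.1 j) (v.2.2 j)), v.1))
        ((measurable_snd.fst.prodMk hYR).prodMk measurable_fst)
        (GaussianIRC.blockLaw_map_noise2 μ1 μ2))
    convert key using 2
    · ext ω j
      simp [GaussianIRC.blockY1, GaussianIRC.blockXR, GaussianIRC.out1]
      ring
    · ext ω j
      simp [GaussianIRC.blockY2, GaussianIRC.blockXR, GaussianIRC.out2]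
      ring
  -- The same argument with sources and destinations exchanged.
  · have key := GaussianIRC.condMutualInfo_le_of_abs_gain_le hc.abs_h22_le
      GaussianIRC.measurable_blockX2
      (by fun_prop : Measurable fun ω : GaussianIRC.Block n => ω.2.2.2.2)
      (by fun_prop : Measurable fun ω : GaussianIRC.Block n => ω.2.2.2.1)
      (by fun_prop : Measurable fun ω => (GaussianIRC.blockX1 ω, c.blockYR ω))
      (hG c.h21 c.h2R) (hG c.h11 c.h1R)
      (GaussianIRC.map_prodMk_of_map_prodMk (by fun_prop) (by fun_prop)
        (g := fun v => ((v.1, fun j => c.relayOut (v.1 j) (v.2.1 j) (v.2.2 j)), v.2.1))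
        ((measurable_fst.prodMk hYR).prodMk measurable_snd.fst)
        (GaussianIRC.blockLaw_map_noise2 μ1 μ2))
      (GaussianIRC.map_prodMk_of_map_prodMk (by fun_prop) (by fun_prop)
        (g := fun v => ((v.1, fun j => c.relayOut (v.1 j) (v.2.1 j) (v.2.2 j)), v.2.1))
        ((measurable_fst.prodMk hYR).prodMk measurable_snd.fst)
        (GaussianIRC.blockLaw_map_noise1 μ1 μ2))
    convert key using 2
    · ext ω j
      simp [GaussianIRC.blockY2, GaussianIRC.blockXR, GaussianIRC.out2]
      ring
    · ext ω j
      simp [GaussianIRC.blockY1, GaussianIRC.blockXR, GaussianIRC.out1]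
      ring
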